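/- Notation. For $A,B\in\mathbb R^{n\times m}$ let $\langle A,B\rangle=\sum_{i,j}A_{ij}B_{ij}$, $\|A\|_F^2=\langle A,A\rangle$ and $\mathbf D_2(A,B)=\|A-B\|_F^2/2$. For a differentiable $\psi:\mathbb R^{n\times m}\to\mathbb R$ let $\boldsymbol\Delta_\psi(\alpha,\beta)=\psi(\alpha)-\psi(\beta)-\langle\nabla\psi(\beta),\alpha-\beta\rangle$. For $B\in\mathbb R^{p\times m}$ let $\|B\|_{2,\mathcal C}$ be the number of distinct rows of $B$ and, for a given $X\in\mathbb R^{n\times p}$, let $$P_o(B)=\{\|B\|_{2,\mathcal C}\wedge \mathrm{rank}(X)+m\}\,\mathrm{rank}(B)+\{p-\|B\|_{2,\mathcal C}\}\log\|B\|_{2,\mathcal C}.$$ For a real random variable $Z$ let $\|Z\|_{\psi_2}=\inf\{t>0:\mathbb E\exp[(Z/t)^2]\le 2\}$. Theorem. For all constants $\delta>0$ and $C\ge 0$ there is $A_0$, depending only on $\delta$ and $C$, such that for every $A\ge A_0$ there is a constant $c>0$, depending only on $\delta,C,A$, with the following property. Let $n,p,m$ be natural numbers, $X\in\mathbb R^{n\times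 p}$ a fixed design matrix, $Y$ a random $n\times m$ response, $l_0(\eta;Y)$ a loss that is differentiable in $\eta\in\mathbb R^{n\times m}$, $B^*\in\mathbb R^{p\times m}$ with $B^*\ne 0$, and $\sigma\ge0$. Put $r^*=\mathrm{rank}(B^*)$ and $q^*=\|B^*\|_{2,\mathcal C}$. Assume that the effective noise $E=-\nabla l_0(XB^*;Y)$ (gradient in the first argument) is a sub-Gaussian random matrix with mean zero and scale bounded by $\sigma$, that is, $\mathbb E E=0$ and $\|\langle E,\alpha\rangle\|_{\psi_2}\le\sigma\|\alpha\|_F$ for all $\alpha\in\mathbb R^{n\times m}$, and that, almost surely, for all $B_1,B_2\in\mathbb R^{p\times m}$, $$\boldsymbol\Delta_{l_0(\cdot;Y)}(XB_1,XB_2)+C\sigma^2P_o(B_1)+C\sigma^2P_o(B_2)\ \ge\ \delta\,\mathbf D_2(XB_1,XB_2).$$ Then any $\hat B$ that (almost surely) minimizes over $B\in\mathbb R^{p\times m}$ the predictive information criterion $$l_0(XB;Y)+A\sigma^2\big[\{\|B\|_{2,\mathcal C}\wedge\mathrm{rank}(X)+m\}\,\mathrm{rank}(B)+\{p-\|B\|_{2,\mathcal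 C}\}\log\|B\|_{2,\mathcal C}\big]$$ satisfies $$\mathbb E\big[\|X\hat B-XB^*\|_F^2\vee \sigma^2P_o(\hat B)\big]\ \le\ c\,\sigma^2\big\{(q^*\wedge\mathrm{rank}(X)+m)r^*+(p-q^*)\log q^*\big\}.$$ -/

import Mathlib

open MeasureTheory

/-- The Frobenius inner product `⟨A, B⟩ = ∑ i j, A i j * B i j`. -/
noncomputable def frobInner {n m : ℕ} (A B : Matrix (Fin n) (Fin m) ℝ) : ℝ :=
  ∑ i, ∑ j, A i j * B i j

/-- The squared Frobenius norm. -/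
noncomputable def frobSq {n m : ℕ} (A : Matrix (Fin n) (Fin m) ℝ) : ℝ :=
  ∑ i, ∑ j, A i j ^ 2

/-- `D₂(A, B) = ‖A - B‖_F² / 2`. -/
noncomputable def D2 {n m : ℕ} (A B : Matrix (Fin n) (Fin m) ℝ) : ℝ :=
  frobSq (A - B) / 2

/-- The gradient of a function of a matrix: the matrix of its partial derivatives, i.e. for a
(Fréchet) differentiable function its gradient for the Frobenius inner product. -/
noncomputable def matGradient {n m : ℕ} (f : Matrix (Fin n) (Fin m) ℝ → ℝ)
    (η : Matrix (Fin n) (Fin m) ℝ) : Matrix (Fin n) (Fin m) ℝ :=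
  Matrix.of fun i j => fderiv ℝ f η (Matrix.single i j 1)

/-- The generalized Bregman function `Δ_ψ(α, β) = ψ(α) - ψ(β) - ⟨∇ψ(β), α - β⟩`. -/
noncomputable def genBregman {n m : ℕ} (ψ : Matrix (Fin n) (Fin m) ℝ → ℝ)
    (α β : Matrix (Fin n) (Fin m) ℝ) : ℝ :=
  ψ α - ψ β - frobInner (matGradient ψ β) (α - β)

/-- `‖B‖_{2,𝒞}`: the number of distinct rows of `B`. -/
noncomputable def numDistinctRows {p m : ℕ} (B : Matrix (Fin p) (Fin m) ℝ) : ℕ :=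
  (Set.range fun i => B i).ncard

/-- The model complexity
`P_o(B) = (‖B‖_{2,𝒞} ∧ rank X + m) rank B + (p - ‖B‖_{2,𝒞}) log ‖B‖_{2,𝒞}`. -/
noncomputable def complexityPo {n p m : ℕ} (X : Matrix (Fin n) (Fin p) ℝ)
    (B : Matrix (Fin p) (Fin m) ℝ) : ℝ :=
  (min (numDistinctRows B : ℝ) (X.rank : ℝ) + (m : ℝ)) * (B.rank : ℝ)
    + ((p : ℝ) - (numDistinctRows B : ℝ)) * Real.log (numDistinctRows B : ℝ)

/-- The predictive information criterion `l₀(XB; y) + A σ² P_o(B)`. The first argument of `l₀` is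
the systematic component, the second one the response. -/
noncomputable def pic {n p m : ℕ}
    (l₀ : Matrix (Fin n) (Fin m) ℝ → Matrix (Fin n) (Fin m) ℝ → ℝ)
    (X : Matrix (Fin n) (Fin p) ℝ) (y : Matrix (Fin n) (Fin m) ℝ) (A σ : ℝ)
    (B : Matrix (Fin p) (Fin m) ℝ) : ℝ :=
  l₀ (X * B) y + A * σ ^ 2 * complexityPo X B

/-- The effective noise `E = -∇ l₀(X B*; Y)`, the gradient being taken in the systematic
component. -/
noncomputable def effectiveNoise {n p m : ℕ} {Ω : Type*}
    (l₀ : Matrix (Fin n) (Fin m) ℝ → Matrix (Fin n) (Fin m) ℝ → ℝ)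
    (X : Matrix (Fin n) (Fin p) ℝ) (Y : Ω → Matrix (Fin n) (Fin m) ℝ)
    (Bstar : Matrix (Fin p) (Fin m) ℝ) (ω : Ω) : Matrix (Fin n) (Fin m) ℝ :=
  -matGradient (fun η => l₀ η (Y ω)) (X * Bstar)

/-- The Orlicz norm `‖Z‖_{ψ₂} = inf {t > 0 : 𝔼 exp((Z / t)²) ≤ 2}`, with values in `[0, ∞]`
(it is `∞` if there is no such `t`). -/
noncomputable def psi2Norm {Ω : Type*} [MeasurableSpace Ω] (μ : Measure Ω) (Z : Ω → ℝ) : ENNReal :=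
  sInf {s : ENNReal | ∃ t : ℝ, 0 < t ∧
    ∫⁻ ω, ENNReal.ofReal (Real.exp ((Z ω / t) ^ 2)) ∂μ ≤ 2 ∧ s = ENNReal.ofReal t}

/-- The random matrix `E` (that is, its vectorization) is sub-Gaussian with mean zero and scale
bounded by `σ`. -/
structure IsCenteredSubGaussian {n m : ℕ} {Ω : Type*} [MeasurableSpace Ω] (μ : Measure Ω)
    (E : Ω → Matrix (Fin n) (Fin m) ℝ) (σ : ℝ) : Prop where
  aemeasurable : ∀ i j, AEMeasurable (fun ω => E ω i j) μ
  mean_zero : ∀ i j, ∫ ω, E ω i j ∂μ = 0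
  psi2_le : ∀ α : Matrix (Fin n) (Fin m) ℝ,
    psi2Norm μ (fun ω => frobInner (E ω) α) ≤ ENNReal.ofReal (σ * Real.sqrt (frobSq α))

/-!
Comparing the criterion at the estimator with its value at `B*` and using the curvature condition
gives `δ/2 ‖T‖² + (A - C) σ² P_o(B) ≤ ⟨E, T⟩ + (A + C) σ² P_o(B*)` for `T = X B - X B*`, so all
rests on a bound of `⟨E, T⟩` by `δ/4 ‖T‖²` plus multiples of `σ² P_o(B)` and `σ² P_o(B*)`, uniform
in `B` up to a random variable of bounded mean.

Let `P` project onto the row space of `X B`. Then `T = T P + X B* (P - 1)`, where the first summand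
has rank at most `rank B` and the second has its columns in the range of `X B*`. The columns of
`T P` lie in a space determined by `B*` and by the partition of the rows of `B` into classes of
equal rows, of dimension at most `q ∧ rank X + r*`. Matrices of rank `r` with columns in a space of
dimension `s` have a net of cardinality `exp(O(r (s + m)))`, which is the first part of the
complexity. A union bound over all partitions with the weights `exp(-3 (p - q) log q)` accounts for
the second part: up to a fixed choice of representatives, at most `C(p - 1, q - 1) q^(p - q)`
partitions have `q` classes, and `C(p - 1, q - 1) ≤ q^(p - q)`, so that the weights are summable.
-/

open Module
open scoped Matrix

section Nets

theorem packingNumber_closedBall_two_le (F : Type*) [NormedAddCommGroup F] [NormedSpace ℝ F]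
    [FiniteDimensional ℝ F] :
    Metric.packingNumber 1 (Metric.closedBall (0 : F) 2) ≤ 5 ^ finrank ℝ F := by
  refine iSup₂_le fun C hC => iSup_le fun hsep => ?_
  by_contra! hlt
  obtain ⟨D, hDC, hD⟩ := Set.exists_subset_encard_eq (Order.add_one_le_of_lt hlt)
  have hfin : D.Finite := Set.finite_of_encard_eq_coe (k := 5 ^ finrank ℝ F + 1) (by simpa using hD)
  have hcard : hfin.toFinset.card ≤ 5 ^ finrank ℝ F := by
    refine Besicovitch.card_le_of_separated _ (fun c hc => ?_) fun c hc d hd hcd => ?_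
    · simpa using hC (hDC (hfin.mem_toFinset.1 hc))
    · have hdist : 1 < edist c d :=
        hsep (hDC (hfin.mem_toFinset.1 hc)) (hDC (hfin.mem_toFinset.1 hd)) hcd
      rw [edist_dist, ENNReal.one_lt_ofReal, dist_eq_norm] at hdist
      exact hdist.le
  rw [hfin.encard_eq_coe_toFinset_card] at hD
  have hD' : hfin.toFinset.card = 5 ^ finrank ℝ F + 1 := by exact_mod_cast hD
  omega

theorem exists_half_net (F : Type*) [NormedAddCommGroup F] [NormedSpace ℝ F]
    [FiniteDimensional ℝ F] :
    ∃ s : Finset F, (∀ c ∈ s, ‖c‖ ≤ 1) ∧ s.card ≤ 5 ^ finrank ℝ F ∧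
      ∀ x : F, ‖x‖ ≤ 1 → ∃ c ∈ s, ‖x - c‖ ≤ 1 / 2 := by
  classical
  have hnum := (Metric.coveringNumber_le_packingNumber 1 (Metric.closedBall (0 : F) 2)).trans
    (packingNumber_closedBall_two_le F)
  obtain ⟨C, hC, hfin, hcover, hcard⟩ := Metric.exists_set_encard_eq_coveringNumber
    (ne_top_of_le_ne_top (by simp) hnum)
  rw [← hcard, hfin.encard_eq_coe_toFinset_card] at hnum
  refine ⟨hfin.toFinset.image fun c => (1 / 2 : ℝ) • c, ?_,
    Finset.card_image_le.trans (by exact_mod_cast hnum), fun x hx => ?_⟩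
  · simp only [Finset.forall_mem_image, Set.Finite.mem_toFinset]
    intro c hc
    have hc2 : ‖c‖ ≤ 2 := by simpa using hC hc
    rw [norm_smul]
    norm_num
    linarith
  · obtain ⟨c, hc, hxc⟩ := hcover (show (2 : ℝ) • x ∈ Metric.closedBall (0 : F) 2 by
      rw [mem_closedBall_zero_iff, norm_smul]; norm_num; linarith)
    refine ⟨_, Finset.mem_image_of_mem _ (hfin.mem_toFinset.2 hc), ?_⟩
    have hdist : ‖(2 : ℝ) • x - c‖ ≤ 1 := by
      have hle : edist ((2 : ℝ) • x) c ≤ 1 := hxc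
      rwa [edist_dist, ENNReal.ofReal_le_one, dist_eq_norm] at hle
    have hscale : x - (1 / 2 : ℝ) • c = (1 / 2 : ℝ) • ((2 : ℝ) • x - c) := by module
    rw [hscale, norm_smul]
    norm_num
    linarith

theorem exists_quarter_net (F : Type*) [NormedAddCommGroup F] [NormedSpace ℝ F]
    [FiniteDimensional ℝ F] :
    ∃ s : Finset F, (∀ c ∈ s, ‖c‖ ≤ 3 / 2) ∧ s.card ≤ 25 ^ finrank ℝ F ∧
      ∀ x : F, ‖x‖ ≤ 1 → ∃ c ∈ s, ‖x - c‖ ≤ 1 / 4 := by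
  classical
  obtain ⟨s, hs, hcard, hnet⟩ := exists_half_net F
  refine ⟨Finset.image₂ (fun a b => a + (1 / 2 : ℝ) • b) s s, ?_, ?_, fun x hx => ?_⟩
  · simp only [Finset.forall_mem_image₂]
    intro a ha b hb
    calc ‖a + (1 / 2 : ℝ) • b‖ ≤ ‖a‖ + 1 / 2 * ‖b‖ := by
          simpa [norm_smul] using norm_add_le a ((1 / 2 : ℝ) • b)
      _ ≤ 3 / 2 := by linarith [hs a ha, hs b hb]
  · calc (Finset.image₂ _ s s).card ≤ s.card * s.card := Finset.card_image₂_le _ _ _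
      _ ≤ 5 ^ finrank ℝ F * 5 ^ finrank ℝ F := Nat.mul_le_mul hcard hcard
      _ = 25 ^ finrank ℝ F := (Nat.mul_pow 5 5 _).symm
  · obtain ⟨a, ha, hxa⟩ := hnet x hx
    obtain ⟨b, hb, hxb⟩ := hnet ((2 : ℝ) • (x - a)) (by rw [norm_smul]; norm_num; linarith)
    refine ⟨_, Finset.mem_image₂_of_mem ha hb, ?_⟩
    have hscale : x - (a + (1 / 2 : ℝ) • b) = (1 / 2 : ℝ) • ((2 : ℝ) • (x - a) - b) := by module
    rw [hscale, norm_smul]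
    norm_num
    linarith

variable {F G : Type*} [NormedAddCommGroup F] [NormedSpace ℝ F] [NormedAddCommGroup G]
  [NormedSpace ℝ G]

theorem norm_le_of_forall_net_le {s : Set F} {t : Set G} (hs : ∀ x ∈ s, ‖x‖ ≤ 3 / 2)
    (hsnet : ∀ x : F, ‖x‖ ≤ 1 → ∃ c ∈ s, ‖x - c‖ ≤ 1 / 4)
    (htnet : ∀ y : G, ‖y‖ ≤ 1 → ∃ c ∈ t, ‖y - c‖ ≤ 1 / 4)
    (β : F →L[ℝ] G →L[ℝ] ℝ) {c : ℝ} (hc : ∀ x ∈ s, ∀ y ∈ t, β x y ≤ c) : ‖β‖ ≤ 3 * c := by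
  have hle : ∀ x y, ‖x‖ ≤ 1 → ‖y‖ ≤ 1 → β x y ≤ c + 5 / 8 * ‖β‖ := fun x y hx hy => by
    obtain ⟨x', hx', hxx⟩ := hsnet x hx
    obtain ⟨y', hy', hyy⟩ := htnet y hy
    calc β x y = β x' y' + β (x - x') y + β x' (y - y') := by
          simp only [map_sub, _root_.sub_apply]; ring
      _ ≤ c + ‖β‖ * ‖x - x'‖ * ‖y‖ + ‖β‖ * ‖x'‖ * ‖y - y'‖ := by
          gcongr
          exacts [hc x' hx' y' hy', (le_abs_self _).trans (β.le_opNorm₂ _ _),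
            (le_abs_self _).trans (β.le_opNorm₂ _ _)]
      _ ≤ c + ‖β‖ * (1 / 4) * 1 + ‖β‖ * (3 / 2) * (1 / 4) := by
          gcongr
          exact hs x' hx'
      _ = c + 5 / 8 * ‖β‖ := by ring
  have hnonneg : 0 ≤ c + 5 / 8 * ‖β‖ := by simpa using hle 0 0 (by simp) (by simp)
  have hnorm : ‖β‖ ≤ c + 5 / 8 * ‖β‖ := by
    refine β.opNorm_le_of_unit_norm hnonneg fun x hx =>
      (β x).opNorm_le_of_unit_norm hnonneg fun y hy => abs_le'.2 ⟨hle x y hx.le hy.le, ?_⟩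
    simpa using hle (-x) y (by simp [hx]) hy.le
  linarith [norm_nonneg β]

theorem exists_bilinear_net (F G : Type*) [NormedAddCommGroup F] [NormedSpace ℝ F]
    [FiniteDimensional ℝ F] [NormedAddCommGroup G] [NormedSpace ℝ G] [FiniteDimensional ℝ G] :
    ∃ N : Finset (F × G), N.card ≤ 25 ^ (finrank ℝ F + finrank ℝ G) ∧
      (∀ x ∈ N, ‖x.1‖ ≤ 3 / 2 ∧ ‖x.2‖ ≤ 3 / 2) ∧
      ∀ (β : F →ₗ[ℝ] G →ₗ[ℝ] ℝ) (c : ℝ), (∀ x ∈ N, β x.1 x.2 ≤ c) →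
        ∀ x y, β x y ≤ 3 * c * (‖x‖ * ‖y‖) := by
  obtain ⟨s, hs, hscard, hsnet⟩ := exists_quarter_net F
  obtain ⟨t, ht, htcard, htnet⟩ := exists_quarter_net G
  refine ⟨s ×ˢ t, ?_, fun x hx => ?_, fun β c hc x y => ?_⟩
  · rw [Finset.card_product, pow_add]
    exact Nat.mul_le_mul hscard htcard
  · rw [Finset.mem_product] at hx
    exact ⟨hs _ hx.1, ht _ hx.2⟩
  · have hnorm : ‖β.toContinuousBilinearMap‖ ≤ 3 * c :=
      norm_le_of_forall_net_le (s := s) (t := t) hs hsnet htnet _ fun x hx y hy =>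
        hc (x, y) (Finset.mk_mem_product hx hy)
    calc β x y ≤ ‖β.toContinuousBilinearMap‖ * ‖x‖ * ‖y‖ :=
          (le_abs_self _).trans (β.toContinuousBilinearMap.le_opNorm₂ x y)
      _ ≤ 3 * c * (‖x‖ * ‖y‖) := by
          rw [mul_assoc]
          gcongr

end Nets

section Frobenius

variable {n m s r : ℕ}

theorem frobInner_eq_trace (A B : Matrix (Fin n) (Fin m) ℝ) : frobInner A B = (Aᵀ * B).trace := by
  simp only [frobInner, Matrix.trace, Matrix.diag, Matrix.mul_apply, Matrix.transpose_apply]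
  exact Finset.sum_comm

theorem frobSq_eq_trace (A : Matrix (Fin n) (Fin m) ℝ) : frobSq A = (Aᵀ * A).trace := by
  rw [← frobInner_eq_trace]
  simp only [frobSq, frobInner, sq]

theorem frobSq_nonneg (A : Matrix (Fin n) (Fin m) ℝ) : 0 ≤ frobSq A :=
  Finset.sum_nonneg fun _ _ => Finset.sum_nonneg fun _ _ => sq_nonneg _

theorem frobSq_transpose (A : Matrix (Fin n) (Fin m) ℝ) : frobSq Aᵀ = frobSq A := by
  simp only [frobSq, Matrix.transpose_apply]
  exact Finset.sum_comm

theorem frobInner_add (E A B : Matrix (Fin n) (Fin m) ℝ) :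
    frobInner E (A + B) = frobInner E A + frobInner E B := by
  simp only [frobInner_eq_trace, Matrix.mul_add, Matrix.trace_add]

theorem frobInner_smul (a : ℝ) (E A : Matrix (Fin n) (Fin m) ℝ) :
    frobInner E (a • A) = a * frobInner E A := by
  simp only [frobInner_eq_trace, Matrix.mul_smul, Matrix.trace_smul, smul_eq_mul]

theorem frobSq_mul_of_orthonormal {Q : Matrix (Fin n) (Fin s) ℝ} (hQ : Qᵀ * Q = 1)
    (Z : Matrix (Fin s) (Fin m) ℝ) : frobSq (Q * Z) = frobSq Z := by
  rw [frobSq_eq_trace, frobSq_eq_trace, Matrix.transpose_mul, Matrix.mul_assoc,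
    ← Matrix.mul_assoc Qᵀ, hQ, Matrix.one_mul]

theorem frobSq_eq_add_of_orthonormal {Q : Matrix (Fin n) (Fin s) ℝ} (hQ : Qᵀ * Q = 1)
    (T : Matrix (Fin n) (Fin m) ℝ) :
    frobSq T = frobSq (Qᵀ * T) + frobSq (T - Q * (Qᵀ * T)) := by
  have hproj : Tᵀ * (Q * (Qᵀ * (Q * (Qᵀ * T)))) = Tᵀ * (Q * (Qᵀ * T)) := by
    rw [← Matrix.mul_assoc Qᵀ Q, hQ, Matrix.one_mul]
  rw [frobSq_eq_trace, frobSq_eq_trace, frobSq_eq_trace, ← Matrix.trace_add]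
  simp only [Matrix.transpose_sub, Matrix.transpose_mul, Matrix.transpose_transpose,
    Matrix.sub_mul, Matrix.mul_sub, Matrix.mul_assoc, hproj, sub_self, sub_zero, add_sub_cancel]

theorem frobSq_transpose_mul_le {Q : Matrix (Fin n) (Fin s) ℝ} (hQ : Qᵀ * Q = 1)
    (T : Matrix (Fin n) (Fin m) ℝ) : frobSq (Qᵀ * T) ≤ frobSq T := by
  linarith [frobSq_eq_add_of_orthonormal hQ T, frobSq_nonneg (T - Q * (Qᵀ * T))]

theorem frobSq_sub_mul_transpose_mul_le {Q : Matrix (Fin n) (Fin s) ℝ} (hQ : Qᵀ * Q = 1)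
    (T : Matrix (Fin n) (Fin m) ℝ) : frobSq (T - Q * (Qᵀ * T)) ≤ frobSq T := by
  linarith [frobSq_eq_add_of_orthonormal hQ T, frobSq_nonneg (Qᵀ * T)]

theorem frobSq_mul_transpose_le {V : Matrix (Fin r) (Fin m) ℝ} (hV : V * Vᵀ = 1)
    (T : Matrix (Fin n) (Fin m) ℝ) : frobSq (T * Vᵀ) ≤ frobSq T := by
  simpa only [← frobSq_transpose T, ← frobSq_transpose (T * Vᵀ), Matrix.transpose_mul,
    Matrix.transpose_transpose] using frobSq_transpose_mul_le (Q := Vᵀ) (by simpa using hV) Tᵀ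

theorem exists_orthonormal_matrix (S : Submodule ℝ (Fin n → ℝ)) :
    ∃ Q : Matrix (Fin n) (Fin (finrank ℝ S)) ℝ, Qᵀ * Q = 1 ∧
      ∀ v ∈ S, Q *ᵥ (Qᵀ *ᵥ v) = v := by
  let e := (WithLp.linearEquiv 2 ℝ (Fin n → ℝ)).symm
  let b := (stdOrthonormalBasis ℝ (S.map e.toLinearMap)).reindex
    (finCongr (LinearEquiv.finrank_map_eq e S))
  let Q : Matrix (Fin n) (Fin (finrank ℝ S)) ℝ :=
    Matrix.of fun i k => (b k : EuclideanSpace ℝ (Fin n)) i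
  have hinner : ∀ k (x : EuclideanSpace ℝ (Fin n)),
      inner ℝ (b k : EuclideanSpace ℝ (Fin n)) x = ∑ i, Q i k * x i := fun k x => by
    rw [PiLp.inner_apply]
    exact Finset.sum_congr rfl fun i _ => by simp [Q, mul_comm]
  refine ⟨Q, ?_, fun v hv => ?_⟩
  · ext k l
    have horth := orthonormal_iff_ite.1 b.orthonormal k l
    rw [Submodule.coe_inner, hinner] at horth
    rw [Matrix.mul_apply, Matrix.one_apply]
    exact horth
  · ext i
    have hsum := congrArg (fun y : S.map e.toLinearMap => (y : EuclideanSpace ℝ (Fin n)) i)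
      (b.sum_repr' ⟨WithLp.toLp 2 v, v, hv, rfl⟩)
    simp only [Submodule.coe_sum, Submodule.coe_smul, Submodule.coe_inner, hinner,
      WithLp.ofLp_sum, Finset.sum_apply, WithLp.ofLp_smul, Pi.smul_apply, smul_eq_mul] at hsum
    exact (Finset.sum_congr rfl fun k _ => mul_comm _ _).trans hsum

theorem mul_transpose_mul_of_range_le {S : Submodule ℝ (Fin n → ℝ)}
    {Q : Matrix (Fin n) (Fin s) ℝ} (hQ : ∀ v ∈ S, Q *ᵥ (Qᵀ *ᵥ v) = v)
    {T : Matrix (Fin n) (Fin m) ℝ} (hT : LinearMap.range T.mulVecLin ≤ S) :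
    Q * (Qᵀ * T) = T :=
  Matrix.mulVec_injective <| funext fun w => by
    simpa only [Matrix.mulVec_mulVec] using hQ (T *ᵥ w) (hT ⟨w, rfl⟩)

theorem exists_orthonormal_rowBasis (T : Matrix (Fin n) (Fin m) ℝ) :
    ∃ V : Matrix (Fin T.rank) (Fin m) ℝ, V * Vᵀ = 1 ∧ T * Vᵀ * V = T := by
  obtain ⟨Q, hQ, hQT⟩ := exists_orthonormal_matrix (LinearMap.range Tᵀ.mulVecLin)
  have hrank : finrank ℝ (LinearMap.range Tᵀ.mulVecLin) = T.rank := T.rank_transpose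
  rw [← hrank]
  refine ⟨Qᵀ, by simpa using hQ, Matrix.transpose_injective ?_⟩
  simpa [Matrix.transpose_mul] using mul_transpose_mul_of_range_le hQT le_rfl

/-- `P` is the orthogonal projection onto the row space of `U`. As `U * P = U`, the part of `U - G`
that it misses involves `G` only. -/
theorem exists_split_sub (U G : Matrix (Fin n) (Fin m) ℝ) :
    ∃ P M : Matrix (Fin m) (Fin m) ℝ, U - G = (U - G) * P + G * M ∧
      ((U - G) * P).rank ≤ U.rank ∧ frobSq ((U - G) * P) ≤ frobSq (U - G) ∧
      frobSq (G * M) ≤ frobSq (U - G) := by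
  obtain ⟨V, hV, hU⟩ := exists_orthonormal_rowBasis U
  have hVt : Vᵀᵀ * Vᵀ = 1 := by simpa using hV
  have hsplit : U - G = (U - G) * (Vᵀ * V) + G * (Vᵀ * V - 1) := by
    rw [Matrix.sub_mul, Matrix.mul_sub, Matrix.mul_one, ← Matrix.mul_assoc U, hU]
    abel
  have hrest : G * (Vᵀ * V - 1) = (U - G) - (U - G) * (Vᵀ * V) := by
    conv_rhs => enter [1]; rw [hsplit]
    abel
  refine ⟨Vᵀ * V, Vᵀ * V - 1, hsplit, ?_, ?_, ?_⟩
  · calc ((U - G) * (Vᵀ * V)).rank ≤ V.rank := by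
          rw [← Matrix.mul_assoc]; exact Matrix.rank_mul_le_right _ _
      _ ≤ U.rank := Matrix.rank_le_height V
  · calc frobSq ((U - G) * (Vᵀ * V)) = frobSq (Vᵀ * ((U - G) * Vᵀ)ᵀ) := by
          rw [← frobSq_transpose]
          simp only [Matrix.transpose_mul, Matrix.transpose_transpose, Matrix.mul_assoc]
      _ = frobSq ((U - G) * Vᵀ) := by rw [frobSq_mul_of_orthonormal hVt, frobSq_transpose]
      _ ≤ frobSq (U - G) := frobSq_mul_transpose_le hV _
  · rw [hrest, ← frobSq_transpose, ← frobSq_transpose (U - G)]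
    simpa only [Matrix.transpose_sub, Matrix.transpose_mul, Matrix.transpose_transpose,
      Matrix.mul_assoc] using frobSq_sub_mul_transpose_mul_le hVt (U - G)ᵀ

end Frobenius

section LowRankNets

open scoped Matrix.Norms.L2Operator

variable {n m s r : ℕ}

theorem l2_opNorm_le_one_of_mul_transpose {V : Matrix (Fin r) (Fin m) ℝ} (hV : V * Vᵀ = 1) :
    ‖V‖ ≤ 1 := by
  have hsq := Matrix.l2_opNorm_conjTranspose_mul_self Vᴴ
  rw [Matrix.conjTranspose_conjTranspose, Matrix.l2_opNorm_conjTranspose,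
    Matrix.conjTranspose_eq_transpose_of_trivial, hV, ← Matrix.diagonal_one,
    Matrix.l2_opNorm_diagonal] at hsq
  have hone : ‖(fun _ => 1 : Fin r → ℝ)‖ ≤ 1 := (pi_norm_le_iff_of_nonneg zero_le_one).2 (by simp)
  nlinarith [norm_nonneg V]

theorem frobSq_mul_le (Z : Matrix (Fin s) (Fin r) ℝ) (V : Matrix (Fin r) (Fin m) ℝ) :
    frobSq (Z * V) ≤ frobSq Z * ‖V‖ ^ 2 := by
  simp only [frobSq, Finset.sum_mul _ _ (‖V‖ ^ 2)]
  refine Finset.sum_le_sum fun i _ => ?_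
  have hrow := Matrix.l2_opNorm_mulVec Vᴴ (WithLp.toLp 2 (Z i))
  rw [Matrix.l2_opNorm_conjTranspose, Matrix.conjTranspose_eq_transpose_of_trivial] at hrow
  have hsq := pow_le_pow_left₀ (norm_nonneg _) hrow 2
  rw [mul_pow, EuclideanSpace.norm_sq_eq, EuclideanSpace.norm_sq_eq, mul_comm] at hsq
  simp only [Real.norm_eq_abs, sq_abs, Matrix.mulVec_transpose] at hsq
  rw [← Finset.sum_mul]
  exact hsq

/-- Vectors indexed by pairs, read as matrices: this equips the space of matrices with its
Frobenius norm while the norm instance on `Matrix` is the operator norm. -/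
def euclideanToMatrix (s r : ℕ) :
    EuclideanSpace ℝ (Fin s × Fin r) →ₗ[ℝ] Matrix (Fin s) (Fin r) ℝ where
  toFun x := Matrix.of fun i j => x (i, j)
  map_add' _ _ := rfl
  map_smul' _ _ := rfl

theorem frobSq_euclideanToMatrix (x : EuclideanSpace ℝ (Fin s × Fin r)) :
    frobSq (euclideanToMatrix s r x) = ‖x‖ ^ 2 := by
  rw [EuclideanSpace.norm_sq_eq, Fintype.sum_prod_type]
  simp only [Real.norm_eq_abs, sq_abs]
  rfl

/-- The bilinear form `(x, V) ↦ ⟨E, Q x V⟩`, through which `⟨E, ·⟩` acts on the matrices of rank at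
most `r` whose columns lie in the span of those of `Q`. -/
noncomputable def frobBilinear (E : Matrix (Fin n) (Fin m) ℝ) (Q : Matrix (Fin n) (Fin s) ℝ)
    (r : ℕ) : EuclideanSpace ℝ (Fin s × Fin r) →ₗ[ℝ] Matrix (Fin r) (Fin m) ℝ →ₗ[ℝ] ℝ :=
  LinearMap.mk₂ ℝ (fun x V => frobInner E (Q * euclideanToMatrix s r x * V))
    (fun x y V => by simp only [map_add, Matrix.mul_add, Matrix.add_mul, frobInner_add])
    (fun a x V => by
      simp only [map_smul, Matrix.mul_smul, Matrix.smul_mul, frobInner_smul, smul_eq_mul])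
    (fun x V W => by simp only [Matrix.mul_add, frobInner_add])
    (fun a x V => by simp only [Matrix.mul_smul, frobInner_smul, smul_eq_mul])

theorem exists_eq_mul_euclideanToMatrix_mul {S : Submodule ℝ (Fin n → ℝ)}
    {Q : Matrix (Fin n) (Fin s) ℝ} (hQ : Qᵀ * Q = 1) (hQS : ∀ v ∈ S, Q *ᵥ (Qᵀ *ᵥ v) = v)
    {T : Matrix (Fin n) (Fin m) ℝ} (hT : LinearMap.range T.mulVecLin ≤ S) :
    ∃ (x : EuclideanSpace ℝ (Fin s × Fin T.rank)) (V : Matrix (Fin T.rank) (Fin m) ℝ),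
      T = Q * euclideanToMatrix s T.rank x * V ∧ ‖x‖ ≤ √(frobSq T) ∧ ‖V‖ ≤ 1 := by
  obtain ⟨V, hV, hTV⟩ := exists_orthonormal_rowBasis T
  let x : EuclideanSpace ℝ (Fin s × Fin T.rank) :=
    WithLp.toLp 2 fun ij => (Qᵀ * (T * Vᵀ)) ij.1 ij.2
  have hx : euclideanToMatrix s T.rank x = Qᵀ * (T * Vᵀ) := rfl
  refine ⟨x, V, ?_, Real.le_sqrt_of_sq_le ?_, l2_opNorm_le_one_of_mul_transpose hV⟩
  · rw [hx, Matrix.mul_assoc, Matrix.mul_assoc Qᵀ, hTV, mul_transpose_mul_of_range_le hQS hT]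
  · rw [← frobSq_euclideanToMatrix, hx]
    exact (frobSq_transpose_mul_le hQ _).trans (frobSq_mul_transpose_le hV T)

theorem exists_lowRank_net (S : Submodule ℝ (Fin n → ℝ)) (r m : ℕ) :
    ∃ N : Finset (Matrix (Fin n) (Fin m) ℝ), N.card ≤ 25 ^ (r * (finrank ℝ S + m)) ∧
      (∀ W ∈ N, frobSq W < 9) ∧
      ∀ (E : Matrix (Fin n) (Fin m) ℝ) (c : ℝ), 0 ≤ c → (∀ W ∈ N, frobInner E W ≤ c) →
        ∀ T : Matrix (Fin n) (Fin m) ℝ, LinearMap.range T.mulVecLin ≤ S → T.rank = r →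
          frobInner E T ≤ 3 * c * √(frobSq T) := by
  classical
  obtain ⟨Q, hQ, hQS⟩ := exists_orthonormal_matrix S
  obtain ⟨N, hcard, hN, hnet⟩ :=
    exists_bilinear_net (EuclideanSpace ℝ (Fin (finrank ℝ S) × Fin r)) (Matrix (Fin r) (Fin m) ℝ)
  refine ⟨N.image fun x => Q * euclideanToMatrix _ r x.1 * x.2,
    Finset.card_image_le.trans (hcard.trans_eq ?_), ?_, ?_⟩
  · rw [finrank_euclideanSpace, Module.finrank_matrix]
    simp [mul_add, mul_comm]
  · simp only [Finset.forall_mem_image]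
    intro x hx
    obtain ⟨hx₁, hx₂⟩ := hN x hx
    calc frobSq (Q * euclideanToMatrix _ r x.1 * x.2) ≤ ‖x.1‖ ^ 2 * ‖x.2‖ ^ 2 := by
          rw [Matrix.mul_assoc, frobSq_mul_of_orthonormal hQ, ← frobSq_euclideanToMatrix]
          exact frobSq_mul_le _ _
      _ ≤ (3 / 2) ^ 2 * (3 / 2) ^ 2 := by gcongr
      _ < 9 := by norm_num
  · rintro E c hc₀ hc T hT rfl
    obtain ⟨x, V, hfactor, hx, hV⟩ := exists_eq_mul_euclideanToMatrix_mul hQ hQS hT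
    calc frobInner E T = frobBilinear E Q T.rank x V := congrArg (frobInner E) hfactor
      _ ≤ 3 * c * (‖x‖ * ‖V‖) := hnet _ c (fun y hy => hc _ (Finset.mem_image_of_mem _ hy)) x V
      _ ≤ 3 * c * (√(frobSq T) * 1) := by gcongr
      _ = 3 * c * √(frobSq T) := by rw [mul_one]

end LowRankNets

section SubGaussian

variable {Ω : Type*} [MeasurableSpace Ω] {μ : Measure Ω}

theorem lintegral_exp_sq_le_of_psi2Norm_lt {Z : Ω → ℝ} {t : ℝ} (ht : 0 < t)
    (h : psi2Norm μ Z < ENNReal.ofReal t) :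
    ∫⁻ ω, ENNReal.ofReal (Real.exp ((Z ω / t) ^ 2)) ∂μ ≤ 2 := by
  obtain ⟨_, ⟨u, hu, hint, rfl⟩, hut⟩ := sInf_lt_iff.1 h
  have hut' : u < t := (ENNReal.ofReal_lt_ofReal_iff ht).1 hut
  refine (lintegral_mono fun ω => ENNReal.ofReal_le_ofReal (Real.exp_le_exp.2 ?_)).trans hint
  rw [div_pow, div_pow]
  gcongr

theorem lintegral_sq_le_of_psi2Norm_lt {Z : Ω → ℝ} {t : ℝ} (ht : 0 < t)
    (h : psi2Norm μ Z < ENNReal.ofReal t) :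
    ∫⁻ ω, ENNReal.ofReal (Z ω ^ 2) ∂μ ≤ ENNReal.ofReal (t ^ 2) * 2 := by
  have hpoint : ∀ ω, Z ω ^ 2 ≤ t ^ 2 * Real.exp ((Z ω / t) ^ 2) := fun ω => by
    calc Z ω ^ 2 = t ^ 2 * (Z ω / t) ^ 2 := by field_simp
      _ ≤ t ^ 2 * Real.exp ((Z ω / t) ^ 2) := by
          gcongr
          linarith [Real.add_one_le_exp ((Z ω / t) ^ 2)]
  calc ∫⁻ ω, ENNReal.ofReal (Z ω ^ 2) ∂μ
      ≤ ∫⁻ ω, ENNReal.ofReal (t ^ 2) * ENNReal.ofReal (Real.exp ((Z ω / t) ^ 2)) ∂μ :=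
        lintegral_mono fun ω =>
          (ENNReal.ofReal_le_ofReal (hpoint ω)).trans_eq (ENNReal.ofReal_mul (by positivity))
    _ = ENNReal.ofReal (t ^ 2) * ∫⁻ ω, ENNReal.ofReal (Real.exp ((Z ω / t) ^ 2)) ∂μ :=
        lintegral_const_mul' _ _ ENNReal.ofReal_ne_top
    _ ≤ ENNReal.ofReal (t ^ 2) * 2 := by
        gcongr
        exact lintegral_exp_sq_le_of_psi2Norm_lt ht h

theorem ae_eq_zero_of_psi2Norm_eq_zero {Z : Ω → ℝ} (hZ : AEMeasurable Z μ)
    (h : psi2Norm μ Z = 0) : ∀ᵐ ω ∂μ, Z ω = 0 := by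
  have hzero : ∫⁻ ω, ENNReal.ofReal (Z ω ^ 2) ∂μ = 0 := by
    refine le_antisymm (ENNReal.le_of_forall_pos_le_add fun ε hε _ => ?_) zero_le
    refine (lintegral_sq_le_of_psi2Norm_lt (t := √(ε / 2)) (by positivity) ?_).trans ?_
    · rw [h, ENNReal.ofReal_pos]
      positivity
    · rw [Real.sq_sqrt (by positivity), zero_add, ← ENNReal.ofReal_ofNat,
        ← ENNReal.ofReal_mul (by positivity)]
      simp
  rw [lintegral_eq_zero_iff' (by fun_prop)] at hzero
  filter_upwards [hzero] with ω hω
  exact pow_eq_zero_iff two_ne_zero |>.1 (le_antisymm (by simpa using hω) (sq_nonneg _))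

/-- Sub-Gaussianity with scale bounded by `σ`, without the centering condition of
`IsCenteredSubGaussian`. -/
structure IsSubGaussianMatrix {n m : ℕ} (μ : Measure Ω) (E : Ω → Matrix (Fin n) (Fin m) ℝ)
    (σ : ℝ) : Prop where
  aemeasurable : ∀ i j, AEMeasurable (fun ω => E ω i j) μ
  psi2_le : ∀ α : Matrix (Fin n) (Fin m) ℝ,
    psi2Norm μ (fun ω => frobInner (E ω) α) ≤ ENNReal.ofReal (σ * √(frobSq α))

variable {n m : ℕ} {E : Ω → Matrix (Fin n) (Fin m) ℝ} {σ : ℝ}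

theorem IsCenteredSubGaussian.isSubGaussianMatrix (hE : IsCenteredSubGaussian μ E σ) :
    IsSubGaussianMatrix μ E σ :=
  ⟨hE.aemeasurable, hE.psi2_le⟩

theorem IsSubGaussianMatrix.aemeasurable_frobInner (hE : IsSubGaussianMatrix μ E σ)
    (W : Matrix (Fin n) (Fin m) ℝ) : AEMeasurable (fun ω => frobInner (E ω) W) μ :=
  Finset.aemeasurable_fun_sum _ fun i _ => Finset.aemeasurable_fun_sum _ fun j _ =>
    (hE.aemeasurable i j).mul_const _

theorem frobInner_single (A : Matrix (Fin n) (Fin m) ℝ) (i : Fin n) (j : Fin m) :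
    frobInner A (Matrix.single i j 1) = A i j := by
  simp [frobInner, Matrix.single_apply, ite_and, Finset.sum_ite_eq]

theorem IsSubGaussianMatrix.ae_eq_zero (hE : IsSubGaussianMatrix μ E 0) :
    ∀ᵐ ω ∂μ, E ω = 0 := by
  have hentry : ∀ i j, ∀ᵐ ω ∂μ, E ω i j = 0 := fun i j =>
    ae_eq_zero_of_psi2Norm_eq_zero (hE.aemeasurable i j) <| by
      simpa [frobInner_single] using hE.psi2_le (Matrix.single i j 1)
  filter_upwards [ae_all_iff.2 fun i => ae_all_iff.2 (hentry i)] with ω hω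
  exact Matrix.ext hω

/-- The exponential sum of squares of the linear functional `⟨E, ·⟩` over a finite set, which
replaces the tail probabilities of a union bound. For `‖W‖_F < 3` the scale `3 * σ` strictly exceeds
the `ψ₂` norm of `⟨E, W⟩`, so that the infimum defining this norm need not be attained. -/
noncomputable def expSqSum (σ : ℝ) (N : Finset (Matrix (Fin n) (Fin m) ℝ))
    (E : Matrix (Fin n) (Fin m) ℝ) : ℝ :=
  ∑ W ∈ N, Real.exp ((frobInner E W / (3 * σ)) ^ 2)

theorem expSqSum_nonneg (σ : ℝ) (N : Finset (Matrix (Fin n) (Fin m) ℝ))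
    (E : Matrix (Fin n) (Fin m) ℝ) : 0 ≤ expSqSum σ N E :=
  Finset.sum_nonneg fun _ _ => (Real.exp_pos _).le

theorem IsSubGaussianMatrix.aemeasurable_expSqSum (hE : IsSubGaussianMatrix μ E σ)
    (N : Finset (Matrix (Fin n) (Fin m) ℝ)) : AEMeasurable (fun ω => expSqSum σ N (E ω)) μ :=
  Finset.aemeasurable_fun_sum _ fun W _ =>
    (((hE.aemeasurable_frobInner W).div_const _).pow_const 2).exp

theorem IsSubGaussianMatrix.lintegral_expSqSum_le (hE : IsSubGaussianMatrix μ E σ)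
    (hσ : 0 < σ) {N : Finset (Matrix (Fin n) (Fin m) ℝ)} (hN : ∀ W ∈ N, frobSq W < 9) :
    ∫⁻ ω, ENNReal.ofReal (expSqSum σ N (E ω)) ∂μ ≤ ENNReal.ofReal (2 * N.card) := by
  have hterm : ∀ W ∈ N,
      ∫⁻ ω, ENNReal.ofReal (Real.exp ((frobInner (E ω) W / (3 * σ)) ^ 2)) ∂μ ≤ 2 := fun W hW => by
    refine lintegral_exp_sq_le_of_psi2Norm_lt (by positivity) ((hE.psi2_le W).trans_lt ?_)
    rw [ENNReal.ofReal_lt_ofReal_iff (by positivity), mul_comm]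
    gcongr
    rw [Real.sqrt_lt' (by norm_num)]
    linarith [hN W hW]
  calc ∫⁻ ω, ENNReal.ofReal (expSqSum σ N (E ω)) ∂μ
      = ∑ W ∈ N, ∫⁻ ω, ENNReal.ofReal (Real.exp ((frobInner (E ω) W / (3 * σ)) ^ 2)) ∂μ := by
        rw [← lintegral_finsetSum' _ fun W _ => by
          have := hE.aemeasurable_frobInner W
          fun_prop]
        exact lintegral_congr fun ω => ENNReal.ofReal_sum_of_nonneg fun _ _ => (Real.exp_pos _).le
    _ ≤ ∑ _W ∈ N, 2 := Finset.sum_le_sum hterm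
    _ = ENNReal.ofReal (2 * N.card) := by
        rw [Finset.sum_const, nsmul_eq_mul, ENNReal.ofReal_mul (by norm_num), mul_comm]
        simp

theorem frobInner_le_of_expSqSum_le (hσ : 0 < σ) {N : Finset (Matrix (Fin n) (Fin m) ℝ)}
    {E : Matrix (Fin n) (Fin m) ℝ} {L R : ℝ} (h : expSqSum σ N E ≤ Real.exp L * R)
    {W : Matrix (Fin n) (Fin m) ℝ} (hW : W ∈ N) : frobInner E W ≤ 3 * σ * √(L + R) := by
  have hexp : Real.exp ((frobInner E W / (3 * σ)) ^ 2) ≤ Real.exp (L + R) := by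
    calc Real.exp ((frobInner E W / (3 * σ)) ^ 2) ≤ expSqSum σ N E :=
          Finset.single_le_sum (f := fun W => Real.exp ((frobInner E W / (3 * σ)) ^ 2))
            (fun _ _ => (Real.exp_pos _).le) hW
      _ ≤ Real.exp L * R := h
      _ ≤ Real.exp L * Real.exp R := by
          gcongr
          linarith [Real.add_one_le_exp R]
      _ = Real.exp (L + R) := (Real.exp_add _ _).symm
  rw [← div_le_iff₀' (by positivity)]
  exact (le_abs_self _).trans (Real.abs_le_sqrt (Real.exp_le_exp.1 hexp))

theorem IsSubGaussianMatrix.exists_forall_net_le (hE : IsSubGaussianMatrix μ E σ) (hσ : 0 ≤ σ)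
    {ι : Type*} (t : Finset ι) (N : ι → Finset (Matrix (Fin n) (Fin m) ℝ))
    (hN : ∀ a, ∀ W ∈ N a, frobSq W < 9) (L : ι → ℝ) :
    ∃ R : Ω → ℝ, (∀ ω, 0 ≤ R ω) ∧
      ∫⁻ ω, ENNReal.ofReal (R ω) ∂μ
        ≤ ENNReal.ofReal (∑ a ∈ t, Real.exp (-L a) * (2 * (N a).card)) ∧
      ∀ᵐ ω ∂μ, ∀ a ∈ t, ∀ W ∈ N a, frobInner (E ω) W ≤ 3 * σ * √(L a + R ω) := by
  rcases hσ.eq_or_lt with rfl | hσ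
  · refine ⟨0, fun _ => le_rfl, by simp, ?_⟩
    filter_upwards [hE.ae_eq_zero] with ω hω a _ W _
    simp [hω, frobInner]
  have hnonneg : ∀ ω a, 0 ≤ Real.exp (-L a) * expSqSum σ (N a) (E ω) := fun ω a =>
    mul_nonneg (Real.exp_pos _).le (expSqSum_nonneg _ _ _)
  refine ⟨fun ω => ∑ a ∈ t, Real.exp (-L a) * expSqSum σ (N a) (E ω),
    fun ω => Finset.sum_nonneg fun a _ => hnonneg ω a, ?_, .of_forall fun ω a ha W hW => ?_⟩
  · calc ∫⁻ ω, ENNReal.ofReal (∑ a ∈ t, Real.exp (-L a) * expSqSum σ (N a) (E ω)) ∂μ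
        = ∑ a ∈ t, ENNReal.ofReal (Real.exp (-L a)) *
            ∫⁻ ω, ENNReal.ofReal (expSqSum σ (N a) (E ω)) ∂μ := by
          simp only [ENNReal.ofReal_sum_of_nonneg fun a _ => hnonneg _ a,
            ENNReal.ofReal_mul (Real.exp_pos _).le]
          rw [lintegral_finsetSum' _ fun a _ =>
            ((hE.aemeasurable_expSqSum (N a)).ennreal_ofReal.const_mul _)]
          simp only [lintegral_const_mul' _ _ ENNReal.ofReal_ne_top]
      _ ≤ ∑ a ∈ t, ENNReal.ofReal (Real.exp (-L a)) * ENNReal.ofReal (2 * (N a).card) := by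
          gcongr with a
          exact hE.lintegral_expSqSum_le hσ (hN a)
      _ = ENNReal.ofReal (∑ a ∈ t, Real.exp (-L a) * (2 * (N a).card)) := by
          rw [ENNReal.ofReal_sum_of_nonneg fun a _ => by positivity]
          simp only [ENNReal.ofReal_mul (Real.exp_pos _).le]
  · refine frobInner_le_of_expSqSum_le hσ ?_ hW
    rw [← inv_mul_le_iff₀ (Real.exp_pos _), ← Real.exp_neg]
    exact Finset.single_le_sum (f := fun a => Real.exp (-L a) * expSqSum σ (N a) (E ω))
      (fun a _ => hnonneg ω a) ha

theorem sum_range_exp_neg_le_two (k : ℕ) : ∑ i ∈ Finset.range k, Real.exp (-i) ≤ 2 := by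
  have hhalf : ∀ i : ℕ, Real.exp (-i) ≤ (1 / 2) ^ i := fun i => by
    rw [← mul_neg_one, Real.exp_nat_mul]
    gcongr
    rw [Real.exp_neg, one_div]
    gcongr
    linarith [Real.add_one_le_exp 1]
  calc ∑ i ∈ Finset.range k, Real.exp (-i) ≤ ∑ i ∈ Finset.range k, (1 / 2 : ℝ) ^ i := by
        gcongr with i
        exact hhalf i
    _ ≤ ∑' i : ℕ, (1 / 2 : ℝ) ^ i := summable_geometric_two.sum_le_tsum _ fun _ _ => by positivity
    _ = 2 := tsum_geometric_two

theorem pow_le_exp_four_mul (d : ℕ) : (25 : ℝ) ^ d ≤ Real.exp (4 * d) := by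
  have h25 : (25 : ℝ) ≤ Real.exp 4 := by
    have he : (2.7 : ℝ) ≤ Real.exp 1 := by linarith [Real.exp_one_gt_d9]
    calc (25 : ℝ) ≤ 2.7 ^ 4 := by norm_num
      _ ≤ Real.exp 1 ^ 4 := by gcongr
      _ = Real.exp 4 := by rw [← Real.exp_nat_mul]; norm_num
  calc (25 : ℝ) ^ d ≤ Real.exp 4 ^ d := by gcongr
    _ = Real.exp (4 * d) := by rw [← Real.exp_nat_mul, mul_comm]

theorem exp_neg_mul_le_of_le_pow {k s m N : ℕ} (hk : k ≤ m) (hN : N ≤ 25 ^ (k * (s + m)))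
    (w : ℝ) :
    Real.exp (-(5 * (k * (s + m)) + w)) * (2 * N) ≤ 2 * Real.exp (-w) * Real.exp (-k) := by
  have hk' : (k : ℝ) ≤ k * (s + m) := by
    rcases Nat.eq_zero_or_pos k with rfl | hk₀
    · simp
    · exact_mod_cast Nat.le_mul_of_pos_right k (by omega)
  have hN' : (N : ℝ) ≤ Real.exp (4 * (k * (s + m))) :=
    (Nat.cast_le.2 hN).trans (by exact_mod_cast pow_le_exp_four_mul (k * (s + m)))
  calc Real.exp (-(5 * (k * (s + m)) + w)) * (2 * N)
      ≤ Real.exp (-(5 * (k * (s + m)) + w)) * (2 * Real.exp (4 * (k * (s + m)))) := by gcongr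
    _ = 2 * Real.exp (-w - k * (s + m)) := by
        rw [mul_left_comm, ← Real.exp_add]
        congr 2
        ring
    _ ≤ 2 * Real.exp (-w - k) := by gcongr
    _ = 2 * Real.exp (-w) * Real.exp (-k) := by rw [mul_assoc, ← Real.exp_add, sub_eq_add_neg]

theorem IsSubGaussianMatrix.exists_forall_range_le (hE : IsSubGaussianMatrix μ E σ) (hσ : 0 ≤ σ)
    {ι : Type*} (t : Finset ι) (S : ι → Submodule ℝ (Fin n → ℝ)) (w : ι → ℝ) :
    ∃ R : Ω → ℝ, (∀ ω, 0 ≤ R ω) ∧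
      ∫⁻ ω, ENNReal.ofReal (R ω) ∂μ ≤ ENNReal.ofReal (4 * ∑ a ∈ t, Real.exp (-w a)) ∧
      ∀ᵐ ω ∂μ, ∀ a ∈ t, ∀ T : Matrix (Fin n) (Fin m) ℝ, LinearMap.range T.mulVecLin ≤ S a →
        frobInner (E ω) T
          ≤ 9 * σ * √(5 * (T.rank * (finrank ℝ (S a) + m)) + w a + R ω) * √(frobSq T) := by
  choose N hcard hN hnet using fun ak : ι × ℕ => exists_lowRank_net (S ak.1) ak.2 m
  let L : ι × ℕ → ℝ := fun ak => 5 * (ak.2 * (finrank ℝ (S ak.1) + m)) + w ak.1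
  obtain ⟨R, hR, hint, hE⟩ := hE.exists_forall_net_le hσ (t ×ˢ Finset.range (m + 1)) N hN L
  refine ⟨R, hR, hint.trans (ENNReal.ofReal_le_ofReal ?_), ?_⟩
  · rw [Finset.sum_product, Finset.mul_sum]
    gcongr with a
    calc ∑ k ∈ Finset.range (m + 1), Real.exp (-L (a, k)) * (2 * (N (a, k)).card)
        ≤ 2 * Real.exp (-w a) * ∑ k ∈ Finset.range (m + 1), Real.exp (-k) := by
          rw [Finset.mul_sum]
          exact Finset.sum_le_sum fun k hk =>
            exp_neg_mul_le_of_le_pow (Finset.mem_range_succ_iff.1 hk) (hcard (a, k)) (w a)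
      _ ≤ 2 * Real.exp (-w a) * 2 := by gcongr; exact sum_range_exp_neg_le_two _
      _ = 4 * Real.exp (-w a) := by ring
  · filter_upwards [hE] with ω hω a ha T hT
    have hrank : (a, T.rank) ∈ t ×ˢ Finset.range (m + 1) :=
      Finset.mk_mem_product ha (Finset.mem_range_succ_iff.2 T.rank_le_width)
    calc frobInner (E ω) T ≤ 3 * (3 * σ * √(L (a, T.rank) + R ω)) * √(frobSq T) :=
          hnet (a, T.rank) _ _ (by positivity) (hω _ hrank) T hT rfl
      _ = _ := by simp only [L]; ring

end SubGaussian

section RowPatterns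

theorem finrank_range_funLeft_le {ι κ : Type*} [Finite ι] (f : ι → κ) :
    finrank ℝ (LinearMap.range (LinearMap.funLeft ℝ ℝ f)) ≤ (Set.range f).ncard := by
  have := Fintype.ofFinite (Set.range f)
  have hcomp : LinearMap.funLeft ℝ ℝ f = LinearMap.funLeft ℝ ℝ (Set.rangeFactorization f) ∘ₗ
      LinearMap.funLeft ℝ ℝ ((↑) : Set.range f → κ) := rfl
  rw [hcomp, ← Nat.card_coe_set_eq, Nat.card_eq_fintype_card,
    ← Module.finrank_fintype_fun_eq_card ℝ]
  exact (Submodule.finrank_mono (LinearMap.range_comp_le_range _ _)).trans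
    (LinearMap.finrank_range_le _)

variable {ι : Type*} [Fintype ι]

/-- The part `(p - q) log q` of the complexity, where `q` is the number of values of the map `g`
on an index set with `p` elements. -/
noncomputable def clusterCost {α : Type*} (g : ι → α) : ℝ :=
  ((Fintype.card ι : ℝ) - (Set.range g).ncard) * Real.log (Set.range g).ncard

theorem ncard_range_le_card {α : Type*} (g : ι → α) : (Set.range g).ncard ≤ Fintype.card ι := by
  rw [← Set.image_univ]
  exact (Set.ncard_image_le Set.finite_univ).trans_eq (by simp [Set.ncard_univ])

theorem clusterCost_nonneg {α : Type*} (g : ι → α) : 0 ≤ clusterCost g :=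
  mul_nonneg (sub_nonneg.2 (by exact_mod_cast ncard_range_le_card g)) (Real.log_natCast_nonneg _)

variable [DecidableEq ι]

/-- The idempotent self-maps fixing `i₀`. Each encodes the partition of the index set into its
fibres; requiring the representative `i₀` for the block of `i₀` reduces the number of codes of
partitions into `q` blocks from `C(p, q) q^(p - q)` to `C(p - 1, q - 1) q^(p - q)`. -/
def representativeMaps (i₀ : ι) : Finset (ι → ι) :=
  Finset.univ.filter fun f => f i₀ = i₀ ∧ ∀ i, f (f i) = f i

theorem card_idempotent_image_eq_le (I : Finset ι) :
    (Finset.univ.filter fun f : ι → ι =>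
      (∀ i, f (f i) = f i) ∧ Finset.univ.image f = I).card
      ≤ I.card ^ (Fintype.card ι - I.card) := by
  have hsub : (Finset.univ.filter fun f : ι → ι => (∀ i, f (f i) = f i) ∧ Finset.univ.image f = I)
      ⊆ Fintype.piFinset fun i => if i ∈ I then {i} else I := by
    intro f hf
    obtain ⟨-, hidem, rfl⟩ := Finset.mem_filter.1 hf
    refine Fintype.mem_piFinset.2 fun i => ?_
    split_ifs with hi
    · obtain ⟨j, -, rfl⟩ := Finset.mem_image.1 hi
      exact Finset.mem_singleton.2 (hidem j)
    · exact Finset.mem_image_of_mem f (Finset.mem_univ i)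
  refine (Finset.card_le_card hsub).trans_eq ?_
  simp only [Fintype.card_piFinset, apply_ite Finset.card, Finset.card_singleton, Finset.prod_ite,
    Finset.prod_const, one_pow, one_mul]
  rw [← Finset.card_compl]
  congr 2
  ext i
  simp

theorem exists_representativeMap {α : Type*} (i₀ : ι) (g : ι → α) :
    ∃ f ∈ representativeMaps i₀, (∀ i, g (f i) = g i) ∧
      (Set.range f).ncard = (Set.range g).ncard := by
  classical
  have : Nonempty ι := ⟨i₀⟩
  let h := Function.update (Function.invFun g) (g i₀) i₀
  have hg : ∀ i, g (h (g i)) = g i := fun i => by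
    rcases eq_or_ne (g i) (g i₀) with hi | hi
    · simp [h, hi]
    · simpa [h, hi] using Function.invFun_eq ⟨i, rfl⟩
  refine ⟨h ∘ g, ?_, hg, ?_⟩
  · simp [representativeMaps, hg, h]
  · rw [Set.range_comp]
    refine Set.InjOn.ncard_image ?_
    rintro _ ⟨i, rfl⟩ _ ⟨j, rfl⟩ hij
    rw [← hg i, ← hg j]
    exact congrArg g hij

theorem sum_inv_succ_pow_le (k : ℕ) :
    ∑ j ∈ Finset.range (k + 1), (((j : ℝ) + 1) ^ (k - j))⁻¹ ≤ 3 := by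
  have htail : ∑ j ∈ Finset.range k, ((((j + 1 : ℕ) : ℝ) + 1) ^ (k - (j + 1)))⁻¹
      ≤ ∑ j ∈ Finset.range k, (1 / 2 : ℝ) ^ (k - 1 - j) := by
    refine Finset.sum_le_sum fun j _ => ?_
    rw [show k - (j + 1) = k - 1 - j by omega, one_div, inv_pow]
    gcongr
    push_cast
    linarith [(Nat.cast_nonneg j : (0 : ℝ) ≤ j)]
  rw [Finset.sum_range_reflect (fun j => (1 / 2 : ℝ) ^ j)] at htail
  rw [Finset.sum_range_succ', Nat.cast_zero, zero_add, one_pow, inv_one]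
  linarith [sum_geometric_two_le k]

theorem sum_choose_mul_inv_le (k : ℕ) :
    ∑ j ∈ Finset.range (k + 1), (k.choose j : ℝ) * ((((j : ℝ) + 1) ^ (k - j)) ^ 2)⁻¹ ≤ 3 := by
  refine (Finset.sum_le_sum fun j hj => ?_).trans (sum_inv_succ_pow_le k)
  have hjk : j ≤ k := Nat.lt_succ_iff.1 (Finset.mem_range.1 hj)
  have hchoose : (k.choose j : ℝ) ≤ ((j : ℝ) + 1) ^ (k - j) := by
    have hle := Nat.choose_le_sub_pow k (k - j)
    rw [Nat.choose_symm hjk, show k + 1 - (k - j) = j + 1 by omega] at hle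
    exact_mod_cast hle
  calc (k.choose j : ℝ) * ((((j : ℝ) + 1) ^ (k - j)) ^ 2)⁻¹
      ≤ ((j : ℝ) + 1) ^ (k - j) * ((((j : ℝ) + 1) ^ (k - j)) ^ 2)⁻¹ := by gcongr
    _ = (((j : ℝ) + 1) ^ (k - j))⁻¹ := by field_simp

theorem exp_neg_three_mul_clusterCost [Nonempty ι] (f : ι → ι) :
    Real.exp (-(3 * clusterCost f)) = ((((Finset.univ.image f).card : ℝ) ^
      (Fintype.card ι - (Finset.univ.image f).card)) ^ 3)⁻¹ := by
  have hrange : (Set.range f).ncard = (Finset.univ.image f).card := by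
    rw [← Set.ncard_coe_finset, Finset.coe_image, Finset.coe_univ, Set.image_univ]
  have hpos : (0 : ℝ) < (Finset.univ.image f).card := by
    exact_mod_cast (Finset.univ_nonempty.image f).card_pos
  have hle : (Finset.univ.image f).card ≤ Fintype.card ι := Finset.card_le_univ _
  rw [clusterCost, hrange, ← Nat.cast_sub hle, ← Real.log_pow, Real.exp_neg, ← Nat.cast_ofNat,
    ← Real.log_pow, Real.exp_log (pow_pos (pow_pos hpos _) _)]

theorem sum_exp_neg_clusterCost_fiber_le {i₀ : ι} {J : Finset ι} (hJ : i₀ ∉ J) :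
    ∑ f ∈ representativeMaps i₀ with (Finset.univ.image f).erase i₀ = J,
        Real.exp (-(3 * clusterCost f))
      ≤ ((((J.card : ℝ) + 1) ^ (Fintype.card ι - (J.card + 1))) ^ 2)⁻¹ := by
  have : Nonempty ι := ⟨i₀⟩
  have hfiber : ∀ f ∈ (representativeMaps i₀).filter (fun f => (Finset.univ.image f).erase i₀ = J),
      (∀ i, f (f i) = f i) ∧ Finset.univ.image f = insert i₀ J := by
    intro f hf
    obtain ⟨hrep, rfl⟩ := Finset.mem_filter.1 hf
    obtain ⟨-, hfix, hidem⟩ := Finset.mem_filter.1 hrep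
    exact ⟨hidem, (Finset.insert_erase (Finset.mem_image.2 ⟨i₀, Finset.mem_univ _, hfix⟩)).symm⟩
  have hcard := (Finset.card_le_card fun f hf => Finset.mem_filter.2
    ⟨Finset.mem_univ f, hfiber f hf⟩).trans (card_idempotent_image_eq_le (insert i₀ J))
  rw [Finset.card_insert_of_notMem hJ] at hcard
  rw [Finset.sum_congr rfl fun f hf => by
    rw [exp_neg_three_mul_clusterCost, (hfiber f hf).2, Finset.card_insert_of_notMem hJ,
      Nat.cast_succ], Finset.sum_const, nsmul_eq_mul]
  set u := ((J.card : ℝ) + 1) ^ (Fintype.card ι - (J.card + 1)) with hu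
  calc _ ≤ u * (u ^ 3)⁻¹ := by
        gcongr
        rw [hu]
        exact_mod_cast hcard
    _ = (u ^ 2)⁻¹ := by field_simp

theorem sum_exp_neg_clusterCost_le (i₀ : ι) :
    ∑ f ∈ representativeMaps i₀, Real.exp (-(3 * clusterCost f)) ≤ 3 := by
  let k := (Finset.univ.erase i₀).card
  have hk : Fintype.card ι = k + 1 := (Finset.card_erase_add_one (Finset.mem_univ i₀)).symm
  have hmaps : ∀ f ∈ representativeMaps i₀,
      (Finset.univ.image f).erase i₀ ∈ (Finset.univ.erase i₀).powerset := fun f _ =>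
    Finset.mem_powerset.2 (Finset.erase_subset_erase _ (Finset.subset_univ _))
  have hfiber : ∀ J ∈ (Finset.univ.erase i₀).powerset,
      ∑ f ∈ representativeMaps i₀ with (Finset.univ.image f).erase i₀ = J,
        Real.exp (-(3 * clusterCost f)) ≤ ((((J.card : ℝ) + 1) ^ (k - J.card)) ^ 2)⁻¹ := by
    intro J hJ
    have hi₀ : i₀ ∉ J := fun h => by simpa using Finset.mem_powerset.1 hJ h
    simpa only [hk, Nat.add_sub_add_right] using sum_exp_neg_clusterCost_fiber_le hi₀
  rw [← Finset.sum_fiberwise_of_maps_to hmaps]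
  refine (Finset.sum_le_sum hfiber).trans ?_
  rw [Finset.sum_powerset_apply_card fun j => ((((j : ℝ) + 1) ^ (k - j)) ^ 2)⁻¹]
  simpa only [nsmul_eq_mul] using sum_choose_mul_inv_le k

/-- The space of the vectors `X v` with `v` constant along the fibres of `f`. -/
noncomputable def patternSpace {n p : ℕ} (X : Matrix (Fin n) (Fin p) ℝ) (f : Fin p → Fin p) :
    Submodule ℝ (Fin n → ℝ) :=
  (LinearMap.range (LinearMap.funLeft ℝ ℝ f)).map X.mulVecLin

theorem finrank_patternSpace_le {n p : ℕ} (X : Matrix (Fin n) (Fin p) ℝ) (f : Fin p → Fin p) :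
    finrank ℝ (patternSpace X f) ≤ min (Set.range f).ncard X.rank :=
  le_min ((Submodule.finrank_map_le _ _).trans (finrank_range_funLeft_le f))
    (Submodule.finrank_mono LinearMap.map_le_range)

theorem range_mul_le_patternSpace {n p m : ℕ} (X : Matrix (Fin n) (Fin p) ℝ) {f : Fin p → Fin p}
    {B : Matrix (Fin p) (Fin m) ℝ} (hB : ∀ i, B (f i) = B i) :
    LinearMap.range (X * B).mulVecLin ≤ patternSpace X f := by
  rintro _ ⟨w, rfl⟩
  refine ⟨B *ᵥ w, ⟨B *ᵥ w, ?_⟩, by simp⟩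
  ext i
  exact congrArg (· ⬝ᵥ w) (hB i)

end RowPatterns

section Complexity

variable {n p m : ℕ} (X : Matrix (Fin n) (Fin p) ℝ)

theorem complexityPo_eq_add_clusterCost (B : Matrix (Fin p) (Fin m) ℝ) :
    complexityPo X B = (min (numDistinctRows B : ℝ) X.rank + m) * B.rank
      + clusterCost fun i => B i := by
  rw [clusterCost, Fintype.card_fin]
  rfl

theorem mul_rank_le_complexityPo (B : Matrix (Fin p) (Fin m) ℝ) :
    (m : ℝ) * B.rank ≤ complexityPo X B := by
  have hmin : 0 ≤ min (numDistinctRows B : ℝ) X.rank * B.rank := by positivity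
  rw [complexityPo_eq_add_clusterCost, add_mul]
  linarith [clusterCost_nonneg fun i => B i]

theorem complexityPo_nonneg (B : Matrix (Fin p) (Fin m) ℝ) : 0 ≤ complexityPo X B :=
  le_trans (by positivity) (mul_rank_le_complexityPo X B)

theorem one_le_complexityPo {B : Matrix (Fin p) (Fin m) ℝ} (hB : B ≠ 0) :
    1 ≤ complexityPo X B := by
  have hrank : 1 ≤ B.rank := by
    rw [Nat.one_le_iff_ne_zero, Matrix.rank, Ne, Submodule.finrank_eq_zero,
      LinearMap.range_eq_bot]
    exact fun h => hB (Matrix.toLin'.injective (h.trans (map_zero _).symm))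
  have hm : 1 ≤ m := hrank.trans B.rank_le_width
  refine le_trans ?_ (mul_rank_le_complexityPo X B)
  exact_mod_cast one_le_mul hm hrank

theorem mul_add_clusterCost_le_complexityPo_add (B Bstar : Matrix (Fin p) (Fin m) ℝ) {k s : ℕ}
    (hk : k ≤ B.rank) (hs : s ≤ min (numDistinctRows B) X.rank + Bstar.rank) :
    (k : ℝ) * (s + m) + clusterCost (fun i => B i) ≤ complexityPo X B + complexityPo X Bstar := by
  have hkm : (k : ℝ) ≤ m := by exact_mod_cast hk.trans B.rank_le_width
  have hs : (s : ℝ) ≤ min (numDistinctRows B : ℝ) X.rank + Bstar.rank := by exact_mod_cast hs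
  have hmul : (k : ℝ) * (s + m)
      ≤ (min (numDistinctRows B : ℝ) X.rank + m) * B.rank + m * Bstar.rank :=
    calc (k : ℝ) * (s + m)
        ≤ k * (min (numDistinctRows B : ℝ) X.rank + Bstar.rank + m) := by gcongr
      _ = (min (numDistinctRows B : ℝ) X.rank + m) * k + k * Bstar.rank := by ring
      _ ≤ _ := by gcongr
  rw [complexityPo_eq_add_clusterCost X B]
  linarith [mul_rank_le_complexityPo X Bstar]

end Complexity

section UniformNoiseBound

variable {n p m : ℕ} (X : Matrix (Fin n) (Fin p) ℝ)

theorem mul_sqrt_mul_sqrt_le {a b K K' t t' : ℝ} (ha : 0 < a) (hb : 0 ≤ b) (ht : t ≤ t')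
    (ht' : 0 ≤ t') (hK : K ≤ K') (hK' : 0 ≤ K') :
    b * √K * √t ≤ a * t' + b ^ 2 / (4 * a) * K' := by
  have hsq : a * t' + b ^ 2 / (4 * a) * K' - b * √K' * √t'
      = (2 * a * √t' - b * √K') ^ 2 / (4 * a) := by
    nth_rewrite 1 [← Real.sq_sqrt hK', ← Real.sq_sqrt ht']
    field_simp
    ring
  calc b * √K * √t ≤ b * √K' * √t' := by gcongr
    _ ≤ a * t' + b ^ 2 / (4 * a) * K' := by
      rw [← sub_nonneg, hsq]
      positivity

theorem range_sub_mul_le {U G : Matrix (Fin n) (Fin m) ℝ} {S : Submodule ℝ (Fin n → ℝ)}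
    (hU : LinearMap.range U.mulVecLin ≤ S) (hG : LinearMap.range G.mulVecLin ≤ S)
    (P : Matrix (Fin m) (Fin m) ℝ) : LinearMap.range ((U - G) * P).mulVecLin ≤ S := by
  rintro _ ⟨v, rfl⟩
  rw [Matrix.mulVecLin_apply, ← Matrix.mulVec_mulVec, Matrix.sub_mulVec]
  exact S.sub_mem (hU ⟨_, rfl⟩) (hG ⟨_, rfl⟩)

theorem range_mul_le (G : Matrix (Fin n) (Fin m) ℝ) (M : Matrix (Fin m) (Fin m) ℝ) :
    LinearMap.range (G * M).mulVecLin ≤ LinearMap.range G.mulVecLin := by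
  rw [Matrix.mulVecLin_mul]
  exact LinearMap.range_comp_le_range _ _

theorem finrank_patternSpace_sup_range_le (f : Fin p → Fin p) (Bstar : Matrix (Fin p) (Fin m) ℝ) :
    finrank ℝ ↥(patternSpace X f ⊔ LinearMap.range (X * Bstar).mulVecLin)
      ≤ min (Set.range f).ncard X.rank + Bstar.rank :=
  (Submodule.finrank_add_le_finrank_add_finrank _ _).trans
    (add_le_add (finrank_patternSpace_le X f) (Matrix.rank_mul_le_right X Bstar))

variable {Ω : Type*} [MeasurableSpace Ω] {μ : Measure Ω} {E : Ω → Matrix (Fin n) (Fin m) ℝ}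
  {σ : ℝ}

theorem IsSubGaussianMatrix.exists_forall_patternSpace_le [NeZero p]
    (hE : IsSubGaussianMatrix μ E σ) (hσ : 0 ≤ σ) (S₀ : Submodule ℝ (Fin n → ℝ)) :
    ∃ R : Ω → ℝ, (∀ ω, 0 ≤ R ω) ∧ ∫⁻ ω, ENNReal.ofReal (R ω) ∂μ ≤ ENNReal.ofReal 16 ∧
      ∀ᵐ ω ∂μ,
        (∀ f ∈ representativeMaps (0 : Fin p), ∀ T : Matrix (Fin n) (Fin m) ℝ,
          LinearMap.range T.mulVecLin ≤ patternSpace X f ⊔ S₀ →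
          frobInner (E ω) T ≤ 9 * σ * √(5 * (T.rank * (finrank ℝ ↥(patternSpace X f ⊔ S₀) + m))
            + 3 * clusterCost f + R ω) * √(frobSq T)) ∧
        ∀ T : Matrix (Fin n) (Fin m) ℝ, LinearMap.range T.mulVecLin ≤ S₀ →
          frobInner (E ω) T
            ≤ 9 * σ * √(5 * (T.rank * (finrank ℝ S₀ + m)) + R ω) * √(frobSq T) := by
  let S : Option (Fin p → Fin p) → Submodule ℝ (Fin n → ℝ) :=
    fun o => o.elim S₀ fun f => patternSpace X f ⊔ S₀
  let w : Option (Fin p → Fin p) → ℝ := fun o => o.elim 0 fun f => 3 * clusterCost f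
  obtain ⟨R, hR, hint, hE⟩ :=
    hE.exists_forall_range_le hσ (Finset.insertNone (representativeMaps 0)) S w
  refine ⟨R, hR, hint.trans (ENNReal.ofReal_le_ofReal ?_), hE.mono fun ω hω =>
    ⟨fun f hf => hω (some f) (Finset.some_mem_insertNone.2 hf), fun T hT =>
      (hω none Finset.none_mem_insertNone T hT).trans_eq
        (by rw [show w none = 0 from rfl, add_zero]; rfl)⟩⟩
  have hsum := sum_exp_neg_clusterCost_le (0 : Fin p)
  simp only [Finset.sum_insertNone, w, Option.elim_none, Option.elim_some, neg_zero,
    Real.exp_zero]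
  linarith

theorem IsSubGaussianMatrix.exists_forall_frobInner_sub_le [NeZero p]
    (hE : IsSubGaussianMatrix μ E σ) (hσ : 0 ≤ σ) (Bstar : Matrix (Fin p) (Fin m) ℝ) :
    ∃ R : Ω → ℝ, (∀ ω, 0 ≤ R ω) ∧ ∫⁻ ω, ENNReal.ofReal (R ω) ∂μ ≤ ENNReal.ofReal 16 ∧
      ∀ᵐ ω ∂μ, ∀ (B : Matrix (Fin p) (Fin m) ℝ) (a : ℝ), 0 < a →
        frobInner (E ω) (X * B - X * Bstar) ≤ 2 * a * frobSq (X * B - X * Bstar)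
          + (9 * σ) ^ 2 / (4 * a)
            * (5 * complexityPo X B + 15 * complexityPo X Bstar + 2 * R ω) := by
  obtain ⟨R, hR, hint, hE⟩ :=
    hE.exists_forall_patternSpace_le X hσ (LinearMap.range (X * Bstar).mulVecLin)
  refine ⟨R, hR, hint, hE.mono fun ω ⟨hpattern, hstar⟩ B a ha => ?_⟩
  obtain ⟨f, hf, hBf, hncard⟩ := exists_representativeMap (0 : Fin p) fun i => B i
  obtain ⟨P, M, hsplit, hrank, hfrob₁, hfrob₂⟩ := exists_split_sub (X * B) (X * Bstar)
  have hcost : clusterCost f = clusterCost fun i => B i := by simp only [clusterCost, hncard]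
  have hdim₁ := mul_add_clusterCost_le_complexityPo_add X B Bstar
    (hrank.trans (Matrix.rank_mul_le_right X B))
    (hncard ▸ finrank_patternSpace_sup_range_le X f Bstar)
  have hdim₂ := mul_add_clusterCost_le_complexityPo_add X Bstar Bstar
    ((Matrix.rank_mul_le_left _ M).trans (Matrix.rank_mul_le_right X Bstar))
    (le_add_left (Matrix.rank_mul_le_right X Bstar) :
      finrank ℝ (LinearMap.range (X * Bstar).mulVecLin) ≤ _)
  have hnonneg := complexityPo_nonneg X B
  have hnonneg' := complexityPo_nonneg X Bstar
  have hcost_nonneg := clusterCost_nonneg fun i => B i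
  have hcost_nonneg' := clusterCost_nonneg fun i => Bstar i
  have hnoise₁ := (hpattern f hf _ (range_sub_mul_le (le_sup_of_le_left
    (range_mul_le_patternSpace X hBf)) le_sup_right P)).trans
    (mul_sqrt_mul_sqrt_le ha (by positivity) hfrob₁ (frobSq_nonneg _)
      (K' := 5 * (complexityPo X B + complexityPo X Bstar) + R ω) (by linarith)
      (by linarith [hR ω]))
  have hnoise₂ := (hstar _ (range_mul_le _ M)).trans
    (mul_sqrt_mul_sqrt_le ha (by positivity) hfrob₂ (frobSq_nonneg _)
      (K' := 10 * complexityPo X Bstar + R ω) (by linarith) (by linarith [hR ω]))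
  calc frobInner (E ω) (X * B - X * Bstar)
      = frobInner (E ω) ((X * B - X * Bstar) * P) + frobInner (E ω) (X * Bstar * M) := by
        rw [← frobInner_add, ← hsplit]
    _ ≤ _ := by linarith

end UniformNoiseBound

section Oracle

theorem max_le_mul_of_mul_add_le {a x y D : ℝ} (ha : 0 < a) (hx : 0 ≤ x) (hy : 0 ≤ y)
    (h : a * x + y ≤ D) : max x y ≤ (1 / a + 1) * D := by
  have hax : 0 ≤ a * x := by positivity
  have hD : 0 ≤ 1 / a * D := mul_nonneg (by positivity) ((add_nonneg hax hy).trans h)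
  have hxD : x ≤ 1 / a * D := by
    rw [one_div_mul_eq_div, le_div_iff₀' ha]
    linarith
  exact max_le (by linarith) (by linarith)

theorem lintegral_ofReal_le_of_le_add_mul {Ω : Type*} [MeasurableSpace Ω] {μ : Measure Ω}
    [IsProbabilityMeasure μ] {g R : Ω → ℝ} {a b ρ : ℝ} (ha : 0 ≤ a) (hb : 0 ≤ b) (hρ : 0 ≤ ρ)
    (hg : ∀ᵐ ω ∂μ, g ω ≤ a + b * R ω)
    (hR : ∫⁻ ω, ENNReal.ofReal (R ω) ∂μ ≤ ENNReal.ofReal ρ) :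
    ∫⁻ ω, ENNReal.ofReal (g ω) ∂μ ≤ ENNReal.ofReal (a + b * ρ) := by
  have hpoint : ∀ᵐ ω ∂μ, ENNReal.ofReal (g ω)
      ≤ ENNReal.ofReal a + ENNReal.ofReal b * ENNReal.ofReal (R ω) := hg.mono fun ω hω => by
    rw [← ENNReal.ofReal_mul hb]
    exact (ENNReal.ofReal_le_ofReal hω).trans ENNReal.ofReal_add_le
  calc ∫⁻ ω, ENNReal.ofReal (g ω) ∂μ
      ≤ ∫⁻ ω, (ENNReal.ofReal a + ENNReal.ofReal b * ENNReal.ofReal (R ω)) ∂μ :=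
        lintegral_mono_ae hpoint
    _ = ENNReal.ofReal a + ENNReal.ofReal b * ∫⁻ ω, ENNReal.ofReal (R ω) ∂μ := by
        rw [lintegral_add_left measurable_const, lintegral_const, measure_univ, mul_one,
          lintegral_const_mul' _ _ ENNReal.ofReal_ne_top]
    _ ≤ ENNReal.ofReal a + ENNReal.ofReal b * ENNReal.ofReal ρ := by gcongr
    _ = ENNReal.ofReal (a + b * ρ) := by
        rw [← ENNReal.ofReal_mul hb, ← ENNReal.ofReal_add ha (by positivity)]

variable {n p m : ℕ} {X : Matrix (Fin n) (Fin p) ℝ}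
  {l₀ : Matrix (Fin n) (Fin m) ℝ → Matrix (Fin n) (Fin m) ℝ → ℝ}

theorem genBregman_eq_add_frobInner_neg (ψ : Matrix (Fin n) (Fin m) ℝ → ℝ)
    (α β : Matrix (Fin n) (Fin m) ℝ) :
    genBregman ψ α β = ψ α - ψ β + frobInner (-matGradient ψ β) (α - β) := by
  simp [genBregman, frobInner, sub_eq_add_neg]

theorem oracle_inequality_of_frobInner_le {y E : Matrix (Fin n) (Fin m) ℝ}
    {B Bstar : Matrix (Fin p) (Fin m) ℝ} {δ C A σ R : ℝ} (hA : C + 810 / δ + 1 ≤ A)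
    (hcurv : δ * D2 (X * B) (X * Bstar) ≤ l₀ (X * B) y - l₀ (X * Bstar) y
      + frobInner E (X * B - X * Bstar)
      + C * σ ^ 2 * complexityPo X B + C * σ ^ 2 * complexityPo X Bstar)
    (hopt : pic l₀ X y A σ B ≤ pic l₀ X y A σ Bstar)
    (hnoise : frobInner E (X * B - X * Bstar) ≤ 2 * (δ / 8) * frobSq (X * B - X * Bstar)
      + (9 * σ) ^ 2 / (4 * (δ / 8)) * (5 * complexityPo X B + 15 * complexityPo X Bstar + 2 * R)) :
    δ / 4 * frobSq (X * B - X * Bstar) + σ ^ 2 * complexityPo X B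
      ≤ σ ^ 2 * ((A + C + 2430 / δ) * complexityPo X Bstar + 324 / δ * R) := by
  have hpen : (C + 810 / δ + 1) * (σ ^ 2 * complexityPo X B)
      ≤ A * (σ ^ 2 * complexityPo X B) :=
    mul_le_mul_of_nonneg_right hA (mul_nonneg (sq_nonneg σ) (complexityPo_nonneg X B))
  have hcoeff : (9 * σ) ^ 2 / (4 * (δ / 8)) = 162 * (σ ^ 2 * δ⁻¹) := by ring
  simp only [D2, pic, hcoeff, div_eq_mul_inv _ δ] at hpen hcurv hopt hnoise ⊢
  linarith

end Oracle

/-- `E` plays the role of the negative gradient of the loss at `X * Bstar`, or of a negative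
subgradient if the loss is not smooth. -/
theorem theorem5_general {δ C A : ℝ} (hδ : 0 < δ) (hC : 0 ≤ C) (hA : C + 810 / δ + 1 ≤ A)
    {n p m : ℕ} {X : Matrix (Fin n) (Fin p) ℝ}
    {l₀ : Matrix (Fin n) (Fin m) ℝ → Matrix (Fin n) (Fin m) ℝ → ℝ}
    {Ω : Type*} [MeasurableSpace Ω] {μ : Measure Ω} [IsProbabilityMeasure μ]
    {Y E : Ω → Matrix (Fin n) (Fin m) ℝ} {Bstar : Matrix (Fin p) (Fin m) ℝ} {σ : ℝ}
    (hσ : 0 ≤ σ) (hBstar : Bstar ≠ 0) (hE : IsSubGaussianMatrix μ E σ)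
    {Bhat : Ω → Matrix (Fin p) (Fin m) ℝ}
    (hcurv : ∀ᵐ ω ∂μ, δ * D2 (X * Bhat ω) (X * Bstar) ≤
      l₀ (X * Bhat ω) (Y ω) - l₀ (X * Bstar) (Y ω) + frobInner (E ω) (X * Bhat ω - X * Bstar)
        + C * σ ^ 2 * complexityPo X (Bhat ω) + C * σ ^ 2 * complexityPo X Bstar)
    (hopt : ∀ᵐ ω ∂μ, pic l₀ X (Y ω) A σ (Bhat ω) ≤ pic l₀ X (Y ω) A σ Bstar) :
    ∫⁻ ω, ENNReal.ofReal
        (max (frobSq (X * Bhat ω - X * Bstar)) (σ ^ 2 * complexityPo X (Bhat ω))) ∂μ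
      ≤ ENNReal.ofReal ((4 / δ + 1) * (A + C + 7614 / δ) * (σ ^ 2 * complexityPo X Bstar)) := by
  have : NeZero p := ⟨by rintro rfl; exact hBstar (Subsingleton.elim _ _)⟩
  have hA₀ : 0 < A := by linarith [show 0 < 810 / δ by positivity]
  have hP : 1 ≤ complexityPo X Bstar := one_le_complexityPo X hBstar
  obtain ⟨R, -, hint, hnoise⟩ := hE.exists_forall_frobInner_sub_le X hσ Bstar
  have hpoint : ∀ᵐ ω ∂μ,
      max (frobSq (X * Bhat ω - X * Bstar)) (σ ^ 2 * complexityPo X (Bhat ω))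
        ≤ (4 / δ + 1) * σ ^ 2 * ((A + C + 2430 / δ) * complexityPo X Bstar)
          + (4 / δ + 1) * σ ^ 2 * (324 / δ) * R ω := by
    filter_upwards [hcurv, hopt, hnoise] with ω hcurv hopt hnoise
    refine (max_le_mul_of_mul_add_le (by positivity) (frobSq_nonneg _)
      (mul_nonneg (sq_nonneg σ) (complexityPo_nonneg X _)) (oracle_inequality_of_frobInner_le hA
        hcurv hopt (hnoise (Bhat ω) (δ / 8) (by positivity)))).trans_eq ?_
    rw [one_div_div]
    ring
  refine (lintegral_ofReal_le_of_le_add_mul (by positivity) (by positivity) (by norm_num) hpoint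
    hint).trans (ENNReal.ofReal_le_ofReal ?_)
  calc _ ≤ (4 / δ + 1) * σ ^ 2 * ((A + C + 2430 / δ) * complexityPo X Bstar)
          + (4 / δ + 1) * σ ^ 2 * (324 / δ) * (16 * complexityPo X Bstar) := by
        gcongr
        linarith
    _ = _ := by ring

theorem theorem5 :
    ∀ δ C : ℝ, 0 < δ → 0 ≤ C →
    ∃ A₀ : ℝ, ∀ A : ℝ, A₀ ≤ A →
    ∃ c : ℝ, 0 < c ∧
    ∀ (n p m : ℕ) (X : Matrix (Fin n) (Fin p) ℝ)
      (l₀ : Matrix (Fin n) (Fin m) ℝ → Matrix (Fin n) (Fin m) ℝ → ℝ)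
      (Ω : Type*) [MeasurableSpace Ω] (μ : Measure Ω) [IsProbabilityMeasure μ]
      (Y : Ω → Matrix (Fin n) (Fin m) ℝ)
      (Bstar : Matrix (Fin p) (Fin m) ℝ) (σ : ℝ),
      0 ≤ σ →
      Bstar ≠ 0 →
      -- the loss is differentiable in the systematic component
      (∀ᵐ ω ∂μ, Differentiable ℝ fun η => l₀ η (Y ω)) →
      IsCenteredSubGaussian μ (effectiveNoise l₀ X Y Bstar) σ →
      -- the restricted curvature condition
      (∀ᵐ ω ∂μ, ∀ B₁ B₂ : Matrix (Fin p) (Fin m) ℝ,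
        δ * D2 (X * B₁) (X * B₂) ≤
          genBregman (fun η => l₀ η (Y ω)) (X * B₁) (X * B₂)
            + C * σ ^ 2 * complexityPo X B₁ + C * σ ^ 2 * complexityPo X B₂) →
      ∀ Bhat : Ω → Matrix (Fin p) (Fin m) ℝ,
        (∀ᵐ ω ∂μ, ∀ B : Matrix (Fin p) (Fin m) ℝ,
          pic l₀ X (Y ω) A σ (Bhat ω) ≤ pic l₀ X (Y ω) A σ B) →
        ∫⁻ ω, ENNReal.ofReal
            (max (frobSq (X * Bhat ω - X * Bstar)) (σ ^ 2 * complexityPo X (Bhat ω))) ∂μ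
          ≤ ENNReal.ofReal (c * (σ ^ 2 * complexityPo X Bstar)) := by
  intro δ C hδ hC
  refine ⟨C + 810 / δ + 1, fun A hA => ⟨(4 / δ + 1) * (A + C + 7614 / δ), ?_, ?_⟩⟩
  · have hA₀ : 0 < A := lt_of_lt_of_le (by positivity) hA
    positivity
  intro n p m X l₀ Ω _ μ _ Y Bstar σ hσ hBstar _ hE hcurv Bhat hopt
  refine theorem5_general hδ hC hA hσ hBstar hE.isSubGaussianMatrix (hcurv.mono fun ω hω => ?_)
    (hopt.mono fun ω hω => hω Bstar)
  exact (hω _ _).trans_eq (by rw [genBregman_eq_add_frobInner_neg]; rfl)
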